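/- **The graph model.** Let $\mathcal S=\mathcal P(\mathbb N)$ with application $UV=\{n\mid \exists m\,(e_m\subseteq V \text{ and } \langle m,n\rangle\in U)\}$, where $e_m$ is the finite set with binary code $m$ and $\langle\cdot,\cdot\rangle$ is a bijection $\mathbb N^2\to\mathbb N$. Write $\overline n=\{n\}$, ${\sf p}UV=\{2n\mid n\in U\}\cup\{2n+1\mid n\in V\}$, and $[U_0,\ldots,U_{N-1}]$ for a standard coding of tuples in $\mathcal S$. **The topos $\mathsf{RT}(\mathcal S)$.** An object $(X,\sim)$ is a set $X$ with sets $[x\sim y]\subseteq\mathcal S$ such that symmetry and transitivity of $\sim$ are realized: there are $s,t\in\mathcal S$ with $sU\in[y\sim x]$ for $U\in[x\sim y]$, and $tUV\in[x\sim z]$ for $U\in[x\sim y]$, $V\in[y\sim z]$. Arrows are functional relations $F(x,y)\subseteq\mathcal S$ (strict, relational, single-valued and total, by realizers), up to realized logical equivalence. **Order-discrete objects.** The Sierpiński object $\Sigma$ is the assembly $(\{0,1\},E)$ with $E(0)=\{\emptyset\}$, $E(1)=\{\{1\}\}$. An object $X$ is *order-discrete* if the diagonal $X\to X^\Sigma$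 is an isomorphism, where $X^\Sigma$ is the set of functions $\{0,1\}\to X$ with $[f\approx g]=\{U\mid \forall i\,\forall V\in E(i),\ UV\in[f(i)\sim g(i)]\}$. **Generic intervals.** For $n\ge 1$ and $\sigma\in\{0,1\}^n$, $I_{n,\sigma}$ is the assembly on $\{0,\ldots,n\}$ in which $k$ has exactly the two realizers $\alpha_k={\sf p}\,\overline k\,A_k$ and $\beta_k={\sf p}\,\overline{k+1}\,B_k$, where $A_k=\emptyset$ if $k\geq 1$ and $\sigma_{k-1}=1$, and $A_k=\overline 1$ otherwise; $B_k=\overline 1$ if $k<n$ and $\sigma_k=1$, and $B_k=\emptyset$ otherwise. (So $\beta_k\subset\alpha_{k+1}$ if $\sigma_k=0$, and $\beta_k\supset\alpha_{k+1}$ if $\sigma_k=1$.) **The exponential $X^{I_{n,\sigma}}$.** Its elements are tuples $\phi=(x_0,y_0,\ldots,x_n,y_n)$ in $X$. The set $E_\sigma(\phi)$ consists of the codes $[U_0,V_0,W_0,\ldots,U_{n-1},V_{n-1},W_{n-1},U_n]$ with $U_k\in[x_k\sim y_k]$ for $0\le k\le n$ and, for $0\le k<n$, $V_k\in[y_k\sim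 y_k]$, $W_k\in[x_{k+1}\sim x_{k+1}]$, $V_k\subseteq W_k$ if $\sigma_k=0$, $V_k\supseteq W_k$ if $\sigma_k=1$. For a second tuple $\phi'=(x_0',y_0',\ldots,x_n',y_n')$, $[\phi\approx_\sigma\phi']$ consists of the codes $[\alpha,\beta,\gamma]$ with $\alpha\in E_\sigma(\phi)$, $\beta\in E_\sigma(\phi')$ and $\gamma\overline k\in[x_k\sim x'_k]$ for $0\le k\le n$. A tuple is regarded as the function $(k,\alpha_k)\mapsto x_k$, $(k,\beta_k)\mapsto y_k$; accordingly, if $f:I_{p,\rho}\to I_{n,\sigma}$ is an arrow of assemblies with tracker $T$, then $\phi f$ is the function $(k,U)\mapsto\phi(f(k),TU)$. **The path object.** The elements of $\mathsf P(X,\sim)$ are all tuples $(\phi,n)=(x_0,y_0,\ldots,x_n,y_n)$ in $X$ with $n\ge1$. The set $[(\phi,n)\sim(\psi,m)]$ consists of the codes $[\alpha,s,\beta]$ such that for some 01-sequences $\sigma,\tau$: $\alpha\in E_\sigma(\phi)$, $\beta\in E_\tau(\psi)$, and there are arrows $f:I_{p,\rho}\to I_{n,\sigma}$ and $g:I_{p,\rho}\to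 I_{m,\tau}$, preserving order and end-points, with trackers for which $s\in[\phi f\approx_\rho\psi g]$. The source and the target of $(\phi,n)$ are $x_0$ and $y_n$. **Proposition.** Let $(X,\sim)$ be an object of $\mathsf{RT}(\mathcal S)$. For $x,y\in X$ let $R(x,y)\subseteq\mathcal S$ interpret "there is a path from $x$ to $y$", i.e. $$R(x,y)=\{[B,U,V]\mid \exists(\phi,n):\ B\in[(\phi,n)\sim(\phi,n)],\ U\in[x_0\sim x],\ V\in[y_n\sim y]\}.$$ Then $R$ is an equivalence relation on $(X,\sim)$ in the internal logic of $\mathsf{RT}(\mathcal S)$ (it is strict, respects $\sim$, and is reflexive, symmetric and transitive, by realizers), and the quotient map $q:(X,\sim)\to(X,R)$ is the order-discrete reflection of $(X,\sim)$: the object $(X,R)$ is order-discrete, and for every order-discrete object $Y$ and every arrow $f:(X,\sim)\to Y$ there is a unique arrow $g:(X,R)\to Y$ with $gq=f$. -/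

import Mathlib

open CategoryTheory

universe u v w

namespace ScottRT

/-! ## Scott's graph model -/

/-- The underlying set of the graph model `𝓢`: the power set of `ℕ`. -/
abbrev S : Type := Set ℕ

/-- The finite set `e_n` coded by `n`: `k ∈ e_n` iff `2 ^ k` occurs in the binary expansion of `n`. -/
def e (n : ℕ) : S := {k | n.testBit k = true}

/-- Application in the graph model: `U V = {n | ∃ m, e_m ⊆ V and ⟨m, n⟩ ∈ U}`. -/
def app (U V : S) : S := {n | ∃ m, e m ⊆ V ∧ Nat.pair m n ∈ U}

infixl:75 " ⬝ " => app

/-- The pairing `p U V = {2n | n ∈ U} ∪ {2n+1 | n ∈ V}` of the graph model. -/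
def pair (U V : S) : S := {k | (∃ n ∈ U, k = 2 * n) ∨ (∃ n ∈ V, k = 2 * n + 1)}

/-- First unpairing map. -/
def fst (U : S) : S := {n | 2 * n ∈ U}

/-- Second unpairing map. -/
def snd (U : S) : S := {n | 2 * n + 1 ∈ U}

/-- The numeral `{n}`. -/
def num (n : ℕ) : S := {n}

/-- The code `[c 0, …, c (N - 1)]` of a tuple of length `N`: it consists of the numeral of the
length together with the set of all `⟨i, k⟩` with `i < N` and `k ∈ c i`. -/
def tuple (N : ℕ) (c : ℕ → S) : S :=
  pair (num N) {j | (Nat.unpair j).1 < N ∧ (Nat.unpair j).2 ∈ c (Nat.unpair j).1}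

/-- The code `[a, b, c]` of a triple. -/
def triple (a b c : S) : S :=
  tuple 3 (fun i => if i = 0 then a else if i = 1 then b else c)

/-- `graph F` codes the function `F`. -/
def graph (F : S → S) : S := {j | (Nat.unpair j).2 ∈ F (e (Nat.unpair j).1)}

/-- Continuity for the Scott topology on the power set of `ℕ`. -/
@[fun_prop]
def Cont (F : S → S) : Prop := ∀ U n, n ∈ F U ↔ ∃ m, e m ⊆ U ∧ n ∈ F (e m)

theorem exists_e_of_finite {s : Set ℕ} (hs : s.Finite) : ∃ m : ℕ, e m = s := by
  refine ⟨Finset.equivBitIndices.symm hs.toFinset, ?_⟩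
  ext k
  have h := congrArg (fun t => k ∈ t)
    (Finset.equivBitIndices.apply_symm_apply hs.toFinset)
  simp only [Finset.equivBitIndices_apply, List.mem_toFinset, Nat.mem_bitIndices,
    Set.Finite.mem_toFinset, eq_iff_iff] at h
  exact h

theorem e_finite (m : ℕ) : (e m).Finite := by
  refine (Set.finite_Iio m).subset fun k hk => ?_
  exact lt_of_lt_of_le Nat.lt_two_pow_self (Nat.ge_two_pow_of_testBit hk)

theorem graph_app {F : S → S} (hF : Cont F) (V : S) : graph F ⬝ V = F V := by
  ext n
  simp [app, graph, hF V n]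

theorem Cont.mono {F : S → S} (hF : Cont F) {U V : S} (h : U ⊆ V) : F U ⊆ F V := by
  intro n hn
  obtain ⟨m, hm, hn⟩ := (hF U n).1 hn
  exact (hF V n).2 ⟨m, hm.trans h, hn⟩

theorem cont_of {F : S → S} (hm : ∀ U V, U ⊆ V → F U ⊆ F V)
    (hf : ∀ U n, n ∈ F U → ∃ m, e m ⊆ U ∧ n ∈ F (e m)) : Cont F := fun U n =>
  ⟨hf U n, fun ⟨_, h, hn⟩ => hm _ _ h hn⟩

@[fun_prop]
theorem cont_id : Cont (fun U => U) := by
  refine cont_of (fun _ _ h => h) fun U n hn => ?_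
  obtain ⟨m, hm⟩ := exists_e_of_finite (Set.finite_singleton n)
  exact ⟨m, by simpa [hm] using hn, by simp [hm]⟩

@[fun_prop]
theorem cont_const (A : S) : Cont (fun _ => A) := by
  refine cont_of (fun _ _ _ => subset_rfl) fun U n hn => ⟨0, ?_, hn⟩
  simp [e]

/-- Finitely many finite conditions can be joined. -/
theorem exists_e_sup {U : S} (a b : ℕ) (ha : e a ⊆ U) (hb : e b ⊆ U) :
    ∃ m, e m ⊆ U ∧ e a ⊆ e m ∧ e b ⊆ e m := by
  obtain ⟨m, hm⟩ := exists_e_of_finite ((e_finite a).union (e_finite b))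
  exact ⟨m, hm ▸ Set.union_subset ha hb, hm ▸ Set.subset_union_left, hm ▸ Set.subset_union_right⟩

@[fun_prop]
theorem cont_app {F G : S → S} (hF : Cont F) (hG : Cont G) : Cont (fun U => F U ⬝ G U) := by
  refine cont_of ?_ ?_
  · rintro U V h n ⟨m, hm, hn⟩
    exact ⟨m, hm.trans (hG.mono h), hF.mono h hn⟩
  · rintro U n ⟨m, hm, hn⟩
    obtain ⟨a, ha, hna⟩ := (hF U _).1 hn
    have key : ∀ s : Set ℕ, s.Finite → s ⊆ G U → ∃ b, e b ⊆ U ∧ s ⊆ G (e b) := by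
      intro s hs
      induction s, hs using Set.Finite.induction_on with
      | empty => exact fun _ => ⟨0, by simp [e], by simp⟩
      | insert _ _ ih =>
        intro h
        obtain ⟨b, hb, hb'⟩ := ih ((Set.subset_insert _ _).trans h)
        obtain ⟨c, hc, hc'⟩ := (hG U _).1 (h (Set.mem_insert _ _))
        obtain ⟨d, hd, h1, h2⟩ := exists_e_sup b c hb hc
        exact ⟨d, hd, Set.insert_subset (hG.mono h2 hc') (hb'.trans (hG.mono h1))⟩
    obtain ⟨b, hb, hb'⟩ := key _ (e_finite m) hm
    obtain ⟨d, hd, h1, h2⟩ := exists_e_sup a b ha hb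
    exact ⟨d, hd, m, hb'.trans (hG.mono h2), hF.mono h1 hna⟩

@[fun_prop]
theorem cont_pair {F G : S → S} (hF : Cont F) (hG : Cont G) : Cont (fun U => pair (F U) (G U)) := by
  refine cont_of ?_ ?_
  · rintro U V h k (⟨n, hn, rfl⟩ | ⟨n, hn, rfl⟩)
    · exact Or.inl ⟨n, hF.mono h hn, rfl⟩
    · exact Or.inr ⟨n, hG.mono h hn, rfl⟩
  · rintro U k (⟨n, hn, rfl⟩ | ⟨n, hn, rfl⟩)
    · obtain ⟨m, hm, h⟩ := (hF U n).1 hn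
      exact ⟨m, hm, Or.inl ⟨n, h, rfl⟩⟩
    · obtain ⟨m, hm, h⟩ := (hG U n).1 hn
      exact ⟨m, hm, Or.inr ⟨n, h, rfl⟩⟩

@[fun_prop]
theorem cont_fst {F : S → S} (hF : Cont F) : Cont (fun U => fst (F U)) := fun U n => hF U (2 * n)

@[fun_prop]
theorem cont_snd {F : S → S} (hF : Cont F) : Cont (fun U => snd (F U)) :=
  fun U n => hF U (2 * n + 1)

@[fun_prop]
theorem cont_graph {F : S → S → S} (hF : ∀ V, Cont (fun U => F U V)) :
    Cont (fun U => graph (F U)) :=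
  fun U j => hF (e (Nat.unpair j).1) U (Nat.unpair j).2

@[simp]
theorem fst_pair (U V : S) : fst (pair U V) = U := by
  ext n
  simp only [fst, pair, Set.mem_ofPred_eq]
  constructor
  · rintro (⟨m, hm, h⟩ | ⟨m, hm, h⟩)
    · obtain rfl : n = m := by omega
      exact hm
    · omega
  · exact fun h => Or.inl ⟨n, h, rfl⟩

@[simp]
theorem snd_pair (U V : S) : snd (pair U V) = V := by
  ext n
  simp only [snd, pair, Set.mem_ofPred_eq]
  constructor
  · rintro (⟨m, hm, h⟩ | ⟨m, hm, h⟩)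
    · omega
    · obtain rfl : n = m := by omega
      exact hm
  · exact fun h => Or.inr ⟨n, h, rfl⟩

/-- Two-variable realizers. -/
theorem graph_app₂ {F : S → S → S} (h₁ : ∀ V, Cont (fun U => F U V)) (h₂ : ∀ U, Cont (F U))
    (U V : S) : graph (fun U => graph (F U)) ⬝ U ⬝ V = F U V := by
  rw [graph_app (cont_graph h₁), graph_app (h₂ U)]

/-! ## The realizability topos over the graph model -/

/-- An object `(X, ∼)` of the Scott realizability topos: a set with a `𝒫(𝓢)`-valued relation
for which symmetry and transitivity are realized. -/
structure Obj where
  carrier : Type u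
  eqv : carrier → carrier → Set S
  symm : ∃ A : S, ∀ x y, ∀ U ∈ eqv x y, A ⬝ U ∈ eqv y x
  trans : ∃ A : S, ∀ x y z, ∀ U ∈ eqv x y, ∀ V ∈ eqv y z, A ⬝ U ⬝ V ∈ eqv x z

instance : CoeSort Obj.{u} (Type u) := ⟨Obj.carrier⟩

/-- A functional relation from `X` to `Y`: strict, relational, single-valued and total, all of
these being realized. -/
structure FunRel (X Y : Obj.{u}) where
  rel : X → Y → Set S
  strict_left : ∃ A : S, ∀ x y, ∀ U ∈ rel x y, A ⬝ U ∈ X.eqv x x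
  strict_right : ∃ A : S, ∀ x y, ∀ U ∈ rel x y, A ⬝ U ∈ Y.eqv y y
  relational : ∃ A : S, ∀ x x' y y', ∀ U ∈ rel x y, ∀ V ∈ X.eqv x x', ∀ W ∈ Y.eqv y y',
    A ⬝ U ⬝ V ⬝ W ∈ rel x' y'
  single_valued : ∃ A : S, ∀ x y y', ∀ U ∈ rel x y, ∀ V ∈ rel x y', A ⬝ U ⬝ V ∈ Y.eqv y y'
  total : ∃ A : S, ∀ x, ∀ U ∈ X.eqv x x, ∃ y, A ⬝ U ∈ rel x y

/-- Entailment of `𝒫(𝓢)`-valued binary predicates. -/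
def Entails {X : Type u} {Y : Type v} (F G : X → Y → Set S) : Prop :=
  ∃ A : S, ∀ x y, ∀ U ∈ F x y, A ⬝ U ∈ G x y

theorem Entails.refl {X : Type u} {Y : Type v} (F : X → Y → Set S) : Entails F F :=
  ⟨graph fun U => U, fun x y U hU => by rw [graph_app (by fun_prop)]; exact hU⟩

theorem Entails.trans {X : Type u} {Y : Type v} {F G H : X → Y → Set S}
    (h₁ : Entails F G) (h₂ : Entails G H) : Entails F H := by
  obtain ⟨A, hA⟩ := h₁
  obtain ⟨B, hB⟩ := h₂
  refine ⟨graph fun U => B ⬝ (A ⬝ U), fun x y U hU => ?_⟩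
  rw [graph_app (by fun_prop)]
  exact hB _ _ _ (hA _ _ _ hU)

/-- Two functional relations represent the same arrow when they entail each other. -/
instance FunRel.setoid (X Y : Obj.{u}) : Setoid (FunRel X Y) where
  r F G := Entails F.rel G.rel ∧ Entails G.rel F.rel
  iseqv :=
    { refl := fun _ => ⟨Entails.refl _, Entails.refl _⟩
      symm := fun h => ⟨h.2, h.1⟩
      trans := fun h k => ⟨h.1.trans k.1, k.2.trans h.2⟩ }

/-- The identity arrow, represented by the relation `∼` itself. -/
def FunRel.id (X : Obj.{u}) : FunRel X X where
  rel := X.eqv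
  strict_left := by
    obtain ⟨s, hs⟩ := X.symm
    obtain ⟨t, ht⟩ := X.trans
    refine ⟨graph fun U => t ⬝ U ⬝ (s ⬝ U), fun x y U hU => ?_⟩
    rw [graph_app (by fun_prop)]
    exact ht _ _ _ _ hU _ (hs _ _ _ hU)
  strict_right := by
    obtain ⟨s, hs⟩ := X.symm
    obtain ⟨t, ht⟩ := X.trans
    refine ⟨graph fun U => t ⬝ (s ⬝ U) ⬝ U, fun x y U hU => ?_⟩
    rw [graph_app (by fun_prop)]
    exact ht _ _ _ _ (hs _ _ _ hU) _ hU
  relational := by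
    obtain ⟨s, hs⟩ := X.symm
    obtain ⟨t, ht⟩ := X.trans
    refine ⟨graph fun U => graph fun V => graph fun W => t ⬝ (t ⬝ (s ⬝ V) ⬝ U) ⬝ W,
      fun x x' y y' U hU V hV W hW => ?_⟩
    rw [graph_app (by fun_prop), graph_app (by fun_prop), graph_app (by fun_prop)]
    exact ht _ _ _ _ (ht _ _ _ _ (hs _ _ _ hV) _ hU) _ hW
  single_valued := by
    obtain ⟨s, hs⟩ := X.symm
    obtain ⟨t, ht⟩ := X.trans
    refine ⟨graph fun U => graph fun V => t ⬝ (s ⬝ U) ⬝ V, fun x y y' U hU V hV => ?_⟩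
    rw [graph_app (by fun_prop), graph_app (by fun_prop)]
    exact ht _ _ _ _ (hs _ _ _ hU) _ hV
  total := ⟨graph fun U => U, fun x U hU => ⟨x, by rw [graph_app (by fun_prop)]; exact hU⟩⟩

/-- Composition of `𝒫(𝓢)`-valued relations: `∃ y, F(x, y) ∧ G(y, z)`. -/
def relComp {X : Type u} {Y : Type v} {Z : Type w} (F : X → Y → Set S) (G : Y → Z → Set S) :
    X → Z → Set S :=
  fun x z => {W | ∃ y, ∃ U ∈ F x y, ∃ V ∈ G y z, W = pair U V}

theorem relComp_mono {X : Type u} {Y : Type v} {Z : Type w} {F F' : X → Y → Set S}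
    {G G' : Y → Z → Set S} (h : Entails F F') (k : Entails G G') :
    Entails (relComp F G) (relComp F' G') := by
  obtain ⟨A, hA⟩ := h
  obtain ⟨B, hB⟩ := k
  refine ⟨graph fun W => pair (A ⬝ fst W) (B ⬝ snd W), ?_⟩
  rintro x z _ ⟨y, U, hU, V, hV, rfl⟩
  rw [graph_app (by fun_prop), fst_pair, snd_pair]
  exact ⟨y, _, hA _ _ _ hU, _, hB _ _ _ hV, rfl⟩

/-- Composition of functional relations. -/
def FunRel.comp {X Y Z : Obj.{u}} (F : FunRel X Y) (G : FunRel Y Z) : FunRel X Z where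
  rel := relComp F.rel G.rel
  strict_left := by
    obtain ⟨A, hA⟩ := F.strict_left
    refine ⟨graph fun W => A ⬝ fst W, ?_⟩
    rintro x z _ ⟨y, U, hU, V, hV, rfl⟩
    rw [graph_app (by fun_prop), fst_pair]
    exact hA _ _ _ hU
  strict_right := by
    obtain ⟨A, hA⟩ := G.strict_right
    refine ⟨graph fun W => A ⬝ snd W, ?_⟩
    rintro x z _ ⟨y, U, hU, V, hV, rfl⟩
    rw [graph_app (by fun_prop), snd_pair]
    exact hA _ _ _ hV
  relational := by
    obtain ⟨A, hA⟩ := F.relational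
    obtain ⟨B, hB⟩ := G.relational
    obtain ⟨C, hC⟩ := F.strict_right
    refine ⟨graph fun U => graph fun V => graph fun W =>
      pair (A ⬝ fst U ⬝ V ⬝ (C ⬝ fst U)) (B ⬝ snd U ⬝ (C ⬝ fst U) ⬝ W), ?_⟩
    rintro x x' z z' _ ⟨y, U, hU, U', hU', rfl⟩ V hV W hW
    rw [graph_app (by fun_prop), graph_app (by fun_prop), graph_app (by fun_prop), fst_pair,
      snd_pair]
    exact ⟨y, _, hA _ _ _ _ _ hU _ hV _ (hC _ _ _ hU), _,
      hB _ _ _ _ _ hU' _ (hC _ _ _ hU) _ hW, rfl⟩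
  single_valued := by
    obtain ⟨A, hA⟩ := F.single_valued
    obtain ⟨B, hB⟩ := G.single_valued
    obtain ⟨C, hC⟩ := G.relational
    obtain ⟨D, hD⟩ := G.strict_right
    refine ⟨graph fun U => graph fun V =>
      B ⬝ (C ⬝ snd U ⬝ (A ⬝ fst U ⬝ fst V) ⬝ (D ⬝ snd U)) ⬝ snd V, ?_⟩
    rintro x z z' _ ⟨y, U, hU, U', hU', rfl⟩ _ ⟨y', V, hV, V', hV', rfl⟩
    rw [graph_app (by fun_prop), graph_app (by fun_prop)]
    simp only [fst_pair, snd_pair]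
    exact hB _ _ _ _ (hC _ _ _ _ _ hU' _ (hA _ _ _ _ hU _ hV) _ (hD _ _ _ hU')) _ hV'
  total := by
    obtain ⟨A, hA⟩ := F.total
    obtain ⟨B, hB⟩ := G.total
    obtain ⟨C, hC⟩ := F.strict_right
    refine ⟨graph fun U => pair (A ⬝ U) (B ⬝ (C ⬝ (A ⬝ U))), fun x U hU => ?_⟩
    obtain ⟨y, hy⟩ := hA x U hU
    obtain ⟨z, hz⟩ := hB y _ (hC _ _ _ hy)
    rw [graph_app (by fun_prop)]
    exact ⟨z, y, _, hy, _, hz, rfl⟩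

/-- The Scott realizability topos `RT(𝓢)`. -/
instance : Category Obj.{u} where
  Hom X Y := Quotient (FunRel.setoid X Y)
  id X := Quotient.mk _ (FunRel.id X)
  comp {X Y Z} f g := Quotient.map₂ FunRel.comp
    (fun (F F' : FunRel X Y) (h : Entails F.rel F'.rel ∧ Entails F'.rel F.rel)
      (G G' : FunRel Y Z) (k : Entails G.rel G'.rel ∧ Entails G'.rel G.rel) =>
      ⟨relComp_mono h.1 k.1, relComp_mono h.2 k.2⟩) f g
  id_comp := by
    rintro X Y ⟨F⟩
    refine Quotient.sound ⟨?_, ?_⟩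
    · obtain ⟨s, hs⟩ := X.symm
      obtain ⟨A, hA⟩ := F.relational
      obtain ⟨B, hB⟩ := F.strict_right
      refine ⟨graph fun W => A ⬝ snd W ⬝ (s ⬝ fst W) ⬝ (B ⬝ snd W), ?_⟩
      rintro x y _ ⟨x', U, hU, V, hV, rfl⟩
      rw [graph_app (by fun_prop), fst_pair, snd_pair]
      exact hA _ _ _ _ _ hV _ (hs _ _ _ hU) _ (hB _ _ _ hV)
    · obtain ⟨A, hA⟩ := F.strict_left
      refine ⟨graph fun U => pair (A ⬝ U) U, fun x y U hU => ?_⟩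
      rw [graph_app (by fun_prop)]
      exact ⟨x, _, hA _ _ _ hU, _, hU, rfl⟩
  comp_id := by
    rintro X Y ⟨F⟩
    refine Quotient.sound ⟨?_, ?_⟩
    · obtain ⟨A, hA⟩ := F.relational
      obtain ⟨B, hB⟩ := F.strict_left
      refine ⟨graph fun W => A ⬝ fst W ⬝ (B ⬝ fst W) ⬝ snd W, ?_⟩
      rintro x y _ ⟨y', U, hU, V, hV, rfl⟩
      rw [graph_app (by fun_prop), fst_pair, snd_pair]
      exact hA _ _ _ _ _ hU _ (hB _ _ _ hU) _ hV
    · obtain ⟨A, hA⟩ := F.strict_right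
      refine ⟨graph fun U => pair U (A ⬝ U), fun x y U hU => ?_⟩
      rw [graph_app (by fun_prop)]
      exact ⟨y, _, hU, _, hA _ _ _ hU, rfl⟩
  assoc := by
    rintro X Y Z T ⟨F⟩ ⟨G⟩ ⟨H⟩
    refine Quotient.sound ⟨?_, ?_⟩
    · refine ⟨graph fun W => pair (fst (fst W)) (pair (snd (fst W)) (snd W)), ?_⟩
      rintro x t _ ⟨z, _, ⟨y, U, hU, V, hV, rfl⟩, W, hW, rfl⟩
      rw [graph_app (by fun_prop)]
      simp only [fst_pair, snd_pair]
      exact ⟨y, U, hU, _, ⟨z, V, hV, W, hW, rfl⟩, rfl⟩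
    · refine ⟨graph fun W => pair (pair (fst W) (fst (snd W))) (snd (snd W)), ?_⟩
      rintro x t _ ⟨y, U, hU, _, ⟨z, V, hV, W, hW, rfl⟩, rfl⟩
      rw [graph_app (by fun_prop)]
      simp only [fst_pair, snd_pair]
      exact ⟨z, _, ⟨y, U, hU, V, hV, rfl⟩, W, hW, rfl⟩

/-- The functional relation `x ∼ x ∧ d x ∼ y` given by a function `d` that preserves `∼`
(with a realizer). -/
def FunRel.ofFun {X Y : Obj.{u}} (d : X → Y)
    (hd : ∃ A : S, ∀ x x', ∀ U ∈ X.eqv x x', A ⬝ U ∈ Y.eqv (d x) (d x')) : FunRel X Y where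
  rel x y := {W | ∃ U ∈ X.eqv x x, ∃ V ∈ Y.eqv (d x) y, W = pair U V}
  strict_left := by
    refine ⟨graph fun W => fst W, ?_⟩
    rintro x y _ ⟨U, hU, V, hV, rfl⟩
    rw [graph_app (by fun_prop), fst_pair]
    exact hU
  strict_right := by
    obtain ⟨A, hA⟩ := (FunRel.id Y).strict_right
    refine ⟨graph fun W => A ⬝ snd W, ?_⟩
    rintro x y _ ⟨U, hU, V, hV, rfl⟩
    rw [graph_app (by fun_prop), snd_pair]
    exact hA _ _ _ hV
  relational := by
    obtain ⟨A, hA⟩ := (FunRel.id X).strict_right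
    obtain ⟨B, hB⟩ := (FunRel.id Y).relational
    obtain ⟨C, hC⟩ := hd
    refine ⟨graph fun U => graph fun V => graph fun W =>
      pair (A ⬝ V) (B ⬝ snd U ⬝ (C ⬝ V) ⬝ W), ?_⟩
    rintro x x' y y' _ ⟨U, hU, U', hU', rfl⟩ V hV W hW
    rw [graph_app (by fun_prop), graph_app (by fun_prop), graph_app (by fun_prop), snd_pair]
    exact ⟨_, hA _ _ _ hV, _, hB _ _ _ _ _ hU' _ (hC _ _ _ hV) _ hW, rfl⟩
  single_valued := by
    obtain ⟨A, hA⟩ := (FunRel.id Y).single_valued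
    refine ⟨graph fun U => graph fun V => A ⬝ snd U ⬝ snd V, ?_⟩
    rintro x y y' _ ⟨U, hU, U', hU', rfl⟩ _ ⟨V, hV, V', hV', rfl⟩
    rw [graph_app (by fun_prop), graph_app (by fun_prop), snd_pair, snd_pair]
    exact hA _ _ _ _ hU' _ hV'
  total := by
    obtain ⟨C, hC⟩ := hd
    refine ⟨graph fun U => pair U (C ⬝ U), fun x U hU => ⟨d x, ?_⟩⟩
    rw [graph_app (by fun_prop)]
    exact ⟨U, hU, _, hC _ _ _ hU, rfl⟩

/-- The arrow of `RT(𝓢)` given by a function that preserves `∼` (with a realizer). -/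
def Obj.homOfFun {X Y : Obj.{u}} (d : X → Y)
    (hd : ∃ A : S, ∀ x x', ∀ U ∈ X.eqv x x', A ⬝ U ∈ Y.eqv (d x) (d x')) : X ⟶ Y :=
  Quotient.mk (FunRel.setoid X Y) (FunRel.ofFun d hd)

/-! ## Assemblies, the Sierpiński object and order-discrete objects -/

/-- An assembly over the graph model. -/
structure Assembly where
  carrier : Type u
  E : carrier → Set S
  nonempty : ∀ x, (E x).Nonempty

/-- `T` tracks the function `f` as a morphism of assemblies. -/
def Tracks (A : Assembly.{u}) (B : Assembly.{v}) (f : A.carrier → B.carrier) (T : S) : Prop :=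
  ∀ x, ∀ U ∈ A.E x, T ⬝ U ∈ B.E (f x)

/-- The Sierpiński object `Σ = ({0, 1}, E)` with `E(0) = {∅}` and `E(1) = {{1}}`. -/
def sierpinski : Assembly.{0} where
  carrier := Bool
  E i := if i then {{1}} else {∅}
  nonempty i := by cases i <;> simp

/-- The exponential `X ^ A` for a partitioned assembly `A`: functions `|A| → |X|` with
`[f ≈ g] = [∀ p, E(p) → f p ∼ g p]`. -/
def Obj.power (X : Obj.{u}) (A : Assembly.{0}) : Obj.{u} where
  carrier := A.carrier → X
  eqv f g := {U | ∀ p, ∀ V ∈ A.E p, U ⬝ V ∈ X.eqv (f p) (g p)}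
  symm := by
    obtain ⟨s, hs⟩ := X.symm
    refine ⟨graph fun U => graph fun V => s ⬝ (U ⬝ V), fun f g U hU p V hV => ?_⟩
    rw [graph_app (by fun_prop), graph_app (by fun_prop)]
    exact hs _ _ _ (hU p V hV)
  trans := by
    obtain ⟨t, ht⟩ := X.trans
    refine ⟨graph fun U => graph fun W => graph fun V => t ⬝ (U ⬝ V) ⬝ (W ⬝ V),
      fun f g h U hU W hW p V hV => ?_⟩
    rw [graph_app (by fun_prop), graph_app (by fun_prop), graph_app (by fun_prop)]
    exact ht _ _ _ _ (hU p V hV) _ (hW p V hV)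

/-- The diagonal `X ⟶ X ^ A`, sending `x` to the constant function with value `x`. -/
def Obj.diag (X : Obj.{u}) (A : Assembly.{0}) : X ⟶ X.power A :=
  Obj.homOfFun (Y := X.power A) (fun x => fun _ => x) (by
    refine ⟨graph fun U => graph fun _ => U, fun x x' U hU p V hV => ?_⟩
    rw [graph_app (by fun_prop), graph_app (by fun_prop)]
    exact hU)

/-- An object is order-discrete if it is orthogonal to the Sierpiński object (which is a
partitioned assembly): the diagonal `X ⟶ X ^ Σ` is an isomorphism. -/
def Obj.OrderDiscrete (X : Obj.{u}) : Prop := IsIso (X.diag sierpinski)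

/-! ## Generic intervals and paths -/

/-- The realizer `α_k` of the point `k` of the interval `I_{n,σ}`: `p k̄ {1}` if `k = 0` or
`σ_{k-1} = 0`, and `p k̄ ∅` if `σ_{k-1} = 1`. -/
def lowR {n : ℕ} (σ : Fin n → Bool) (k : Fin (n + 1)) : S :=
  pair (num (k : ℕ)) (if ∃ j : Fin n, j.succ = k ∧ σ j = true then ∅ else {1})

/-- The realizer `β_k` of the point `k` of the interval `I_{n,σ}`, whose first component is the
numeral of `k + 1` and whose second component is `∅` if `k = n` or `σ_k = 0`, and `{1}` if
`σ_k = 1`. -/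
def highR {n : ℕ} (σ : Fin n → Bool) (k : Fin (n + 1)) : S :=
  pair (num ((k : ℕ) + 1)) (if ∃ j : Fin n, j.castSucc = k ∧ σ j = true then {1} else ∅)

/-- The generic interval `I_{n,σ}` (of interest for `n ≥ 1`). -/
def interval {n : ℕ} (σ : Fin n → Bool) : Assembly.{0} where
  carrier := Fin (n + 1)
  E k := {lowR σ k, highR σ k}
  nonempty k := ⟨lowR σ k, by simp⟩

/-- An arrow `I_{p,ρ} ⟶ I_{n,σ}` that preserves order and end-points, with a chosen tracker. -/
structure IntervalMap {p n : ℕ} (ρ : Fin p → Bool) (σ : Fin n → Bool) where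
  toFun : Fin (p + 1) → Fin (n + 1)
  tracker : S
  tracks : Tracks (interval ρ) (interval σ) toFun tracker
  monotone : Monotone toFun
  map_zero : toFun 0 = 0
  map_last : toFun (Fin.last p) = Fin.last n

/-- A tuple `(x_0, y_0, …, x_n, y_n)` of elements of a set. -/
structure PathTuple (X : Type u) (n : ℕ) where
  x : Fin (n + 1) → X
  y : Fin (n + 1) → X

open Classical in
/-- A tuple as a function on the pairs `(k, U)` with `U ∈ E_{n,σ}(k) = {α_k, β_k}`:
`(k, α_k) ↦ x_k` and `(k, β_k) ↦ y_k`. -/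
noncomputable def PathTuple.eval {X : Type u} {n : ℕ} (φ : PathTuple X n) (σ : Fin n → Bool)
    (k : Fin (n + 1)) (U : S) : X :=
  if U = lowR σ k then φ.x k else φ.y k

/-- The composite `φ f` of a tuple, seen as a function on the pairs `(k, U)` with
`U ∈ E_{n,σ}(k)`, with an arrow `f : I_{p,ρ} ⟶ I_{n,σ}`. -/
noncomputable def PathTuple.comp {X : Type u} {p n : ℕ} {ρ : Fin p → Bool} {σ : Fin n → Bool}
    (φ : PathTuple X n) (f : IntervalMap ρ σ) : PathTuple X p where
  x k := φ.eval σ (f.toFun k) (f.tracker ⬝ lowR ρ k)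
  y k := φ.eval σ (f.toFun k) (f.tracker ⬝ highR ρ k)

/-- The existence predicate `E(φ)` of the exponential `X ^ I_{n,σ}`: codes of `(3n+1)`-tuples
`[U_0, V_0, W_0, …, U_{n-1}, V_{n-1}, W_{n-1}, U_n]` with `U_k ∈ [x_k ∼ y_k]`,
`V_k ∈ [y_k ∼ y_k]`, `W_k ∈ [x_{k+1} ∼ x_{k+1}]`, and `V_k ⊆ W_k` if `σ_k = 0`,
`W_k ⊆ V_k` if `σ_k = 1`. -/
def intervalExt (X : Obj.{u}) {n : ℕ} (σ : Fin n → Bool) (φ : PathTuple X n) : Set S :=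
  {A | ∃ c : ℕ → S, A = tuple (3 * n + 1) c ∧
    (∀ k : Fin (n + 1), c (3 * (k : ℕ)) ∈ X.eqv (φ.x k) (φ.y k)) ∧
    ∀ k : Fin n,
      c (3 * (k : ℕ) + 1) ∈ X.eqv (φ.y k.castSucc) (φ.y k.castSucc) ∧
      c (3 * (k : ℕ) + 2) ∈ X.eqv (φ.x k.succ) (φ.x k.succ) ∧
      (σ k = false → c (3 * (k : ℕ) + 1) ⊆ c (3 * (k : ℕ) + 2)) ∧
      (σ k = true → c (3 * (k : ℕ) + 2) ⊆ c (3 * (k : ℕ) + 1))}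

/-- The equality `[φ ≈ ψ]` of the exponential `X ^ I_{n,σ}`. -/
def intervalEq (X : Obj.{u}) {n : ℕ} (σ : Fin n → Bool) (φ ψ : PathTuple X n) : Set S :=
  {A | ∃ α β γ : S, A = triple α β γ ∧ α ∈ intervalExt X σ φ ∧ β ∈ intervalExt X σ ψ ∧
    ∀ k : Fin (n + 1), γ ⬝ num (k : ℕ) ∈ X.eqv (φ.x k) (ψ.x k)}

/-- The `𝒫(𝓢)`-valued equality `[(φ, n) ∼ (ψ, m)]` of the path object `P(X, ∼)`. -/
def pathEq (X : Obj.{u}) {n m : ℕ} (φ : PathTuple X n) (ψ : PathTuple X m) : Set S :=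
  {A | ∃ α s β : S, A = triple α s β ∧ ∃ (σ : Fin n → Bool) (τ : Fin m → Bool),
    α ∈ intervalExt X σ φ ∧ β ∈ intervalExt X τ ψ ∧
    ∃ (p : ℕ) (ρ : Fin p → Bool) (f : IntervalMap ρ σ) (g : IntervalMap ρ τ),
      1 ≤ p ∧ s ∈ intervalEq X ρ (φ.comp f) (ψ.comp g)}

/-- The relation "there is a path from `x` to `y`": there is an element `(φ, n)` of the path
object (with `n ≥ 1`) whose source `x_0` equals `x` and whose target `y_n` equals `y`. -/
def pathRel (X : Obj.{u}) (x y : X) : Set S :=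
  {A | ∃ n : ℕ, 1 ≤ n ∧ ∃ φ : PathTuple X n, ∃ B ∈ pathEq X φ φ,
    ∃ U ∈ X.eqv (φ.x 0) x, ∃ V ∈ X.eqv (φ.y (Fin.last n)) y, A = triple B U V}

/-! ## Quotients -/

/-- `R` is an equivalence relation on the object `X`, in the internal logic of `RT(𝓢)`. -/
structure Obj.IsEquivRel (X : Obj.{u}) (R : X → X → Set S) : Prop where
  strict_left : ∃ A : S, ∀ x y, ∀ U ∈ R x y, A ⬝ U ∈ X.eqv x x
  strict_right : ∃ A : S, ∀ x y, ∀ U ∈ R x y, A ⬝ U ∈ X.eqv y y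
  relational : ∃ A : S, ∀ x x' y y', ∀ U ∈ R x y, ∀ V ∈ X.eqv x x', ∀ W ∈ X.eqv y y',
    A ⬝ U ⬝ V ⬝ W ∈ R x' y'
  refl : ∃ A : S, ∀ x, ∀ U ∈ X.eqv x x, A ⬝ U ∈ R x x
  symm : ∃ A : S, ∀ x y, ∀ U ∈ R x y, A ⬝ U ∈ R y x
  trans : ∃ A : S, ∀ x y z, ∀ U ∈ R x y, ∀ V ∈ R y z, A ⬝ U ⬝ V ∈ R x z

/-- The quotient `X / R` of an object by an equivalence relation. -/
def Obj.quot (X : Obj.{u}) (R : X → X → Set S) (hR : X.IsEquivRel R) : Obj.{u} where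
  carrier := X
  eqv := R
  symm := hR.symm
  trans := hR.trans

/-- The quotient map `X ⟶ X / R`. -/
def Obj.quotMap (X : Obj.{u}) (R : X → X → Set S) (hR : X.IsEquivRel R) : X ⟶ X.quot R hR :=
  Obj.homOfFun (Y := X.quot R hR) (fun x => x) (by
    obtain ⟨A, hA⟩ := hR.refl
    obtain ⟨B, hB⟩ := hR.relational
    obtain ⟨C, hC⟩ := (FunRel.id X).strict_left
    refine ⟨graph fun U => B ⬝ (A ⬝ (C ⬝ U)) ⬝ (C ⬝ U) ⬝ U, fun x x' U hU => ?_⟩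
    rw [graph_app (by fun_prop)]
    exact hB _ _ _ _ _ (hA _ _ (hC _ _ _ hU)) _ (hC _ _ _ hU) _ hU)

/-- `q : X ⟶ Q` is the order-discrete reflection of `X`: `Q` is order-discrete, and every arrow
from `X` to an order-discrete object factors uniquely through `q`. -/
def IsOrderDiscreteReflection {X Q : Obj.{u}} (q : X ⟶ Q) : Prop :=
  Q.OrderDiscrete ∧
    ∀ Y : Obj.{u}, Y.OrderDiscrete → ∀ f : X ⟶ Y, ∃! g : Q ⟶ Y, q ≫ g = f

end ScottRT

namespace ScottRT

/-! ## More continuous operations -/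

/-! Everything rests on application being monotone for inclusion (`app_mono`): every realizer
carries comparable realizers to comparable realizers.

Order-discreteness has an elementary form (`orderDiscrete_iff`): inclusion between realizers of
existence forces equality, by a uniform realizer. A map out of Σ into Y amounts to such an
inclusion, and the diagonal being onto says that its two values agree.

In a realizer of "there is a path", only the code of the tuple and the two end-point equalities
matter: the arrows between intervals can always be taken to be identities. So `pathRel` is
interchangeable with `chainRel`, where a chain alternates edges (equalities in X) with links
(comparable realizers of existence) and has the prescribed end-points on the nose
(`entails_chainRel`, `chainRel_entails`). The direction of a link need not be known to the
realizers. Chains can be reversed and concatenated, and equalities give chains of length one, so the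
relation is an equivalence.

The quotient is order-discrete because strictness turns comparable realizers for R into comparable
realizers for X, which form a single link. Conversely, a functional relation F to an order-discrete
Y can be transported along a chain (`FunRel.exists_transport`): relationality handles the edges, and
at a link totality yields comparable realizers of existence in Y, hence equal values. So F itself is
a functional relation on the quotient, and it is the only candidate up to equivalence, since
composing with q does not change the underlying relation. -/

theorem app_mono {A A' U U' : S} (h : A ⊆ A') (k : U ⊆ U') : A ⬝ U ⊆ A' ⬝ U' := by
  rintro n ⟨m, hm, hn⟩
  exact ⟨m, hm.trans k, h hn⟩

@[fun_prop]
theorem cont_ite {P : Prop} [Decidable P] {F G : S → S} (hF : Cont F) (hG : Cont G) :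
    Cont (fun U => if P then F U else G U) := by
  split_ifs
  · exact hF
  · exact hG

@[fun_prop]
theorem cont_union {F G : S → S} (hF : Cont F) (hG : Cont G) : Cont (fun U => F U ∪ G U) := by
  refine cont_of (fun U V h => Set.union_subset_union (hF.mono h) (hG.mono h)) ?_
  rintro U n (hn | hn)
  · obtain ⟨m, hm, h⟩ := (hF U n).1 hn
    exact ⟨m, hm, Or.inl h⟩
  · obtain ⟨m, hm, h⟩ := (hG U n).1 hn
    exact ⟨m, hm, Or.inr h⟩

@[fun_prop]
theorem cont_inter {F G : S → S} (hF : Cont F) (hG : Cont G) : Cont (fun U => F U ∩ G U) := by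
  refine cont_of (fun U V h => Set.inter_subset_inter (hF.mono h) (hG.mono h)) ?_
  rintro U n ⟨hn, hn'⟩
  obtain ⟨a, ha, h⟩ := (hF U n).1 hn
  obtain ⟨b, hb, h'⟩ := (hG U n).1 hn'
  obtain ⟨m, hm, h1, h2⟩ := exists_e_sup a b ha hb
  exact ⟨m, hm, hF.mono h1 h, hG.mono h2 h'⟩

/-- The union of the sets `f n` for `n ∈ A`: the branch `f n` if `A` is the numeral of `n`. -/
def bindNum (A : S) (f : ℕ → S) : S := {j | ∃ n ∈ A, j ∈ f n}

@[simp]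
theorem bindNum_num (n : ℕ) (f : ℕ → S) : bindNum (num n) f = f n := by
  ext j
  simp [bindNum, num]

@[fun_prop]
theorem cont_bindNum {F : S → S} {G : ℕ → S → S} (hF : Cont F) (hG : ∀ n, Cont (G n)) :
    Cont (fun U => bindNum (F U) (fun n => G n U)) := by
  refine cont_of ?_ ?_
  · rintro U V h j ⟨n, hn, hj⟩
    exact ⟨n, hF.mono h hn, (hG n).mono h hj⟩
  · rintro U j ⟨n, hn, hj⟩
    obtain ⟨a, ha, h⟩ := (hF U n).1 hn
    obtain ⟨b, hb, h'⟩ := (hG n U j).1 hj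
    obtain ⟨m, hm, h1, h2⟩ := exists_e_sup a b ha hb
    exact ⟨m, hm, n, hF.mono h1 h, (hG n).mono h2 h'⟩

/-- The entry with index `i` of a coded tuple. -/
def proj (i : ℕ) (A : S) : S := {k | Nat.pair i k ∈ snd A}

@[fun_prop]
theorem cont_proj {i : ℕ} {F : S → S} (hF : Cont F) : Cont (fun U => proj i (F U)) :=
  fun U k => cont_snd hF U (Nat.pair i k)

@[fun_prop]
theorem cont_tuple {N : ℕ} {c : ℕ → S → S} (hc : ∀ i, Cont (c i)) :
    Cont (fun U => tuple N (fun i => c i U)) := by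
  refine cont_pair (cont_const _) fun U j => ?_
  simp only [Set.mem_ofPred_eq, hc _ U (Nat.unpair j).2]
  tauto

@[simp]
theorem fst_tuple (N : ℕ) (c : ℕ → S) : fst (tuple N c) = num N := fst_pair _ _

theorem proj_tuple {N i : ℕ} (h : i < N) (c : ℕ → S) : proj i (tuple N c) = c i := by
  ext k
  simp [proj, tuple, h]

@[fun_prop]
theorem cont_triple {F G H : S → S} (hF : Cont F) (hG : Cont G) (hH : Cont H) :
    Cont (fun U => triple (F U) (G U) (H U)) := by
  unfold triple
  fun_prop

@[simp]
theorem proj_zero_triple (a b c : S) : proj 0 (triple a b c) = a := proj_tuple (by norm_num) _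

@[simp]
theorem proj_one_triple (a b c : S) : proj 1 (triple a b c) = b := proj_tuple (by norm_num) _

@[simp]
theorem proj_two_triple (a b c : S) : proj 2 (triple a b c) = c := proj_tuple (by norm_num) _

theorem tuple_congr {N : ℕ} {c d : ℕ → S} (h : ∀ i < N, c i = d i) : tuple N c = tuple N d := by
  unfold tuple
  congr 1
  ext j
  simp only [Set.mem_ofPred_eq]
  exact and_congr_right fun hj => by rw [h _ hj]

/-- The code of a tuple of length four. -/
def quad (a b c d : S) : S :=
  tuple 4 (fun i => if i = 0 then a else if i = 1 then b else if i = 2 then c else d)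

@[fun_prop]
theorem cont_quad {F G H K : S → S} (hF : Cont F) (hG : Cont G) (hH : Cont H) (hK : Cont K) :
    Cont (fun U => quad (F U) (G U) (H U) (K U)) := by
  unfold quad
  fun_prop

/-! ## Isomorphisms and order-discrete objects -/

/-- A functional relation with realized injectivity and surjectivity has an inverse. -/
def FunRel.inv {X Y : Obj.{u}} (F : FunRel X Y)
    (inj : ∃ A : S, ∀ x x' y, ∀ U ∈ F.rel x y, ∀ V ∈ F.rel x' y, A ⬝ U ⬝ V ∈ X.eqv x x')
    (surj : ∃ A : S, ∀ y, ∀ U ∈ Y.eqv y y, ∃ x, A ⬝ U ∈ F.rel x y) : FunRel Y X where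
  rel y x := F.rel x y
  strict_left := F.strict_right.imp fun _ h x y => h y x
  strict_right := F.strict_left.imp fun _ h x y => h y x
  relational := by
    obtain ⟨A, hA⟩ := F.relational
    refine ⟨graph fun U => graph fun V => graph fun W => A ⬝ U ⬝ W ⬝ V,
      fun y y' x x' U hU V hV W hW => ?_⟩
    rw [graph_app (by fun_prop), graph_app (by fun_prop), graph_app (by fun_prop)]
    exact hA _ _ _ _ _ hU _ hW _ hV
  single_valued := inj.imp fun _ h y x x' => h x x' y
  total := surj

/-- The inverse is the opposite relation: injectivity makes it single-valued and surjectivity makes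
it total. No categorical structure beyond this is needed to test order-discreteness. -/
theorem isIso_mk {X Y : Obj.{u}} (F : FunRel X Y)
    (inj : ∃ A : S, ∀ x x' y, ∀ U ∈ F.rel x y, ∀ V ∈ F.rel x' y, A ⬝ U ⬝ V ∈ X.eqv x x')
    (surj : ∃ A : S, ∀ y, ∀ U ∈ Y.eqv y y, ∃ x, A ⬝ U ∈ F.rel x y) :
    IsIso (C := Obj.{u}) (X := X) (Y := Y) (Quotient.mk (FunRel.setoid X Y) F) := by
  obtain ⟨A, hA⟩ := inj
  obtain ⟨B, hB⟩ := surj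
  obtain ⟨C, hC⟩ := F.total
  obtain ⟨D, hD⟩ := F.strict_right
  obtain ⟨K, hK⟩ := F.single_valued
  obtain ⟨L, hL⟩ := F.relational
  obtain ⟨P, hP⟩ := (FunRel.id X).strict_left
  obtain ⟨P', hP'⟩ := (FunRel.id Y).strict_left
  obtain ⟨Q, hQ⟩ := F.strict_left
  refine ⟨Quotient.mk (FunRel.setoid Y X) (F.inv ⟨A, hA⟩ ⟨B, hB⟩),
    Quotient.sound ⟨?_, ?_⟩, Quotient.sound ⟨?_, ?_⟩⟩
  · refine ⟨graph fun W => A ⬝ fst W ⬝ snd W, ?_⟩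
    rintro x x' _ ⟨y, U, hU, V, hV, rfl⟩
    rw [graph_app (by fun_prop), fst_pair, snd_pair]
    exact hA _ _ _ _ hU _ hV
  · refine ⟨graph fun U => pair (C ⬝ (P ⬝ U))
      (L ⬝ (C ⬝ (P ⬝ U)) ⬝ U ⬝ (D ⬝ (C ⬝ (P ⬝ U)))), fun x x' U hU => ?_⟩
    rw [graph_app (by fun_prop)]
    obtain ⟨y, hy⟩ := hC _ _ (hP _ _ _ hU)
    exact ⟨y, _, hy, _, hL _ _ _ _ _ hy _ hU _ (hD _ _ _ hy), rfl⟩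
  · refine ⟨graph fun W => K ⬝ fst W ⬝ snd W, ?_⟩
    rintro y y' _ ⟨x, U, hU, V, hV, rfl⟩
    rw [graph_app (by fun_prop), fst_pair, snd_pair]
    exact hK _ _ _ _ hU _ hV
  · refine ⟨graph fun U => pair (B ⬝ (P' ⬝ U))
      (L ⬝ (B ⬝ (P' ⬝ U)) ⬝ (Q ⬝ (B ⬝ (P' ⬝ U))) ⬝ U), fun y y' U hU => ?_⟩
    rw [graph_app (by fun_prop)]
    obtain ⟨x, hx⟩ := hB _ _ (hP' _ _ _ hU)
    exact ⟨x, _, hx, _, hL _ _ _ _ _ hx _ (hQ _ _ _ hx) _ hU, rfl⟩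

theorem exists_surj_of_isIso {X Y : Obj.{u}} (F : FunRel X Y)
    (h : IsIso (C := Obj.{u}) (X := X) (Y := Y) (Quotient.mk (FunRel.setoid X Y) F)) :
    ∃ A : S, ∀ y, ∀ U ∈ Y.eqv y y, ∃ x, A ⬝ U ∈ F.rel x y := by
  obtain ⟨G, -, hG⟩ := h
  induction G using Quotient.inductionOn with
  | h G =>
    obtain ⟨A, hA⟩ := (Quotient.exact hG).2
    -- `A` realizes that the identity entails `G` followed by `F`; the second component of its
    -- output is a realizer of `F`.
    refine ⟨graph fun U => snd (A ⬝ U), fun y U hU => ?_⟩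
    obtain ⟨x, V, -, W, hW, h⟩ := hA y y U hU
    exact ⟨x, by rwa [graph_app (by fun_prop), h, snd_pair]⟩

/-- An object is order-discrete if and only if realizers of existence that are comparable for
inclusion belong to equal elements, with a realizer for the equality. -/
theorem orderDiscrete_iff {Y : Obj.{u}} : Y.OrderDiscrete ↔
    ∃ H : S, ∀ a b, ∀ U ∈ Y.eqv a a, ∀ V ∈ Y.eqv b b, U ⊆ V → H ⬝ U ⬝ V ∈ Y.eqv a b := by
  obtain ⟨s, hs⟩ := Y.symm
  obtain ⟨t, ht⟩ := Y.trans
  constructor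
  · intro h
    obtain ⟨A, hA⟩ := exists_surj_of_isIso _ h
    -- The inner graph yields `U` at `∅` and `U ∪ V` at `{1}`, which is `V` as `U ⊆ V`; it realizes
    -- the function 0 ↦ a, 1 ↦ b. Surjectivity of the diagonal then gives a point equal to both
    -- values.
    let R : S → S → S := fun U V =>
      snd (A ⬝ graph fun W => U ∪ bindNum W fun _ => V)
    refine ⟨graph fun U => graph fun V =>
      t ⬝ (s ⬝ (R U V ⬝ ∅)) ⬝ (R U V ⬝ {1}), fun a b U hU V hV hUV => ?_⟩
    rw [graph_app₂ (by intro; simp only [R]; fun_prop) (by intro; simp only [R]; fun_prop)]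
    obtain ⟨x, W, -, Z, hZ, h⟩ := hA (fun i : Bool => if i then b else a)
      (graph fun W => U ∪ bindNum W fun _ => V) (by
        intro i W hW
        rw [graph_app (by fun_prop)]
        cases i
        · obtain rfl : W = ∅ := by simpa [sierpinski] using hW
          simpa [bindNum] using hU
        · obtain rfl : W = {1} := by simpa [sierpinski] using hW
          simpa [bindNum, Set.union_eq_self_of_subset_left hUV] using hV)
    have hR : R U V = Z := by simp only [R, h, snd_pair]
    rw [hR]
    have h0 := hZ false ∅ (by simp [sierpinski])
    have h1 := hZ true {1} (by simp [sierpinski])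
    exact ht _ _ _ _ (hs _ _ _ h0) _ h1
  · rintro ⟨H, hH⟩
    refine isIso_mk _ ?_ ?_
    · refine ⟨graph fun U => graph fun V => t ⬝ (snd U ⬝ ∅) ⬝ (s ⬝ (snd V ⬝ ∅)), ?_⟩
      rintro x x' f _ ⟨U, hU, U', hU', rfl⟩ _ ⟨V, hV, V', hV', rfl⟩
      rw [graph_app (by fun_prop), graph_app (by fun_prop), snd_pair, snd_pair]
      exact ht _ _ _ _ (hU' false ∅ (by simp [sierpinski])) _
        (hs _ _ _ (hV' false ∅ (by simp [sierpinski])))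
    -- The value at 0 represents `f`: by monotonicity `U ⬝ ∅` lies below every `U ⬝ V`.
    · refine ⟨graph fun U => pair (U ⬝ ∅) (graph fun V => H ⬝ (U ⬝ ∅) ⬝ (U ⬝ V)),
        fun f U hU => ⟨f false, ?_⟩⟩
      rw [graph_app (by fun_prop)]
      have h0 := hU false ∅ (by simp [sierpinski])
      refine ⟨_, h0, _, ?_, rfl⟩
      intro i V hV
      rw [graph_app (by fun_prop)]
      exact hH _ _ _ h0 _ (hU i V hV) (app_mono subset_rfl (Set.empty_subset V))

theorem Obj.OrderDiscrete.exists_of_comparable {Y : Obj.{u}} (h : Y.OrderDiscrete) :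
    ∃ H : S, ∀ a b, ∀ U ∈ Y.eqv a a, ∀ V ∈ Y.eqv b b, (U ⊆ V ∨ V ⊆ U) →
      H ⬝ U ⬝ V ∈ Y.eqv a b := by
  obtain ⟨H, hH⟩ := orderDiscrete_iff.1 h
  obtain ⟨s, hs⟩ := Y.symm
  obtain ⟨t, ht⟩ := Y.trans
  -- `U ∩ V` is whichever of the two is smaller, so comparing both with it gives one realizer for
  -- both directions.
  refine ⟨graph fun U => graph fun V => t ⬝ (s ⬝ (H ⬝ (U ∩ V) ⬝ U)) ⬝ (H ⬝ (U ∩ V) ⬝ V), ?_⟩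
  rintro a b U hU V hV (hUV | hUV)
  · rw [graph_app (by fun_prop), graph_app (by fun_prop), Set.inter_eq_left.2 hUV]
    exact ht _ _ _ _ (hs _ _ _ (hH _ _ _ hU _ hU subset_rfl)) _ (hH _ _ _ hU _ hV hUV)
  · rw [graph_app (by fun_prop), graph_app (by fun_prop), Set.inter_eq_right.2 hUV]
    exact ht _ _ _ _ (hs _ _ _ (hH _ _ _ hV _ hU hUV)) _ (hH _ _ _ hV _ hV subset_rfl)

/-! ## Chains -/

/-- `c` realizes that `(x 0, y 0, …, x n, y n)` is a path of length `n`, of some type `σ`. -/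
structure IsChain (X : Obj.{u}) (n : ℕ) (x y : ℕ → X) (c : ℕ → S) : Prop where
  edge : ∀ k ≤ n, c (3 * k) ∈ X.eqv (x k) (y k)
  high : ∀ k < n, c (3 * k + 1) ∈ X.eqv (y k) (y k)
  low : ∀ k < n, c (3 * k + 2) ∈ X.eqv (x (k + 1)) (x (k + 1))
  comparable : ∀ k < n, c (3 * k + 1) ⊆ c (3 * k + 2) ∨ c (3 * k + 2) ⊆ c (3 * k + 1)

/-- The relation "there is a chain of positive length from `a` to `b`". -/
def chainRel (X : Obj.{u}) (a b : X) : Set S :=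
  {A | ∃ n ≥ 1, ∃ x y c, IsChain X n x y c ∧ x 0 = a ∧ y n = b ∧ A = tuple (3 * n + 1) c}

/-! ### Interchanging chains and paths. -/

theorem IsChain.exists_mem_intervalExt {X : Obj.{u}} {n : ℕ} {x y : ℕ → X} {c : ℕ → S}
    (h : IsChain X n x y c) : ∃ σ : Fin n → Bool,
      tuple (3 * n + 1) c ∈ intervalExt X σ ⟨fun k => x k, fun k => y k⟩ := by
  classical
  -- The type σ is not part of the code, so it may be chosen classically.
  refine ⟨fun k => decide (¬ c (3 * (k : ℕ) + 1) ⊆ c (3 * (k : ℕ) + 2)), c, rfl,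
    fun k => h.edge k (by omega), fun k => ⟨h.high k k.2, h.low k k.2, fun hk => ?_, fun hk => ?_⟩⟩
  · simpa using hk
  · exact (h.comparable k k.2).resolve_left (by simpa using hk)

theorem exists_isChain {X : Obj.{u}} {n : ℕ} {σ : Fin n → Bool} {φ : PathTuple X n} {A : S}
    (h : A ∈ intervalExt X σ φ) : ∃ x y c, IsChain X n x y c ∧ A = tuple (3 * n + 1) c ∧
      x 0 = φ.x 0 ∧ y n = φ.y (Fin.last n) := by
  obtain ⟨c, rfl, h₀, h₁⟩ := h
  -- Indices are read modulo `n + 1`; the values beyond `n` play no role in `IsChain`.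
  refine ⟨fun k => φ.x (Fin.ofNat (n + 1) k), fun k => φ.y (Fin.ofNat (n + 1) k), c, ?_, rfl,
    rfl, congrArg φ.y (Fin.ext (by simp))⟩
  have key : ∀ k (hk : k < n), Fin.ofNat (n + 1) k = (⟨k, hk⟩ : Fin n).castSucc ∧
      Fin.ofNat (n + 1) (k + 1) = (⟨k, hk⟩ : Fin n).succ := fun k hk =>
    ⟨Fin.ext (Nat.mod_eq_of_lt (by omega)), Fin.ext (Nat.mod_eq_of_lt (by omega))⟩
  refine ⟨fun k hk => ?_, fun k hk => ?_, fun k hk => ?_, fun k hk => ?_⟩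
  · have e : ((Fin.ofNat (n + 1) k : Fin (n + 1)) : ℕ) = k := Nat.mod_eq_of_lt (by omega)
    simpa only [e] using h₀ (Fin.ofNat (n + 1) k)
  · rw [(key k hk).1]
    exact (h₁ ⟨k, hk⟩).1
  · rw [(key k hk).2]
    exact (h₁ ⟨k, hk⟩).2.1
  · cases hσ : σ ⟨k, hk⟩
    · exact Or.inl ((h₁ ⟨k, hk⟩).2.2.1 hσ)
    · exact Or.inr ((h₁ ⟨k, hk⟩).2.2.2 hσ)

/-- The identity arrow of an interval. -/
def IntervalMap.id {n : ℕ} (σ : Fin n → Bool) : IntervalMap σ σ where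
  toFun k := k
  tracker := graph fun U => U
  tracks k U hU := by rwa [graph_app (by fun_prop)]
  monotone _ _ h := h
  map_zero := rfl
  map_last := rfl

/-- The first components are the numerals of `k + 1` and `k`. Hence the test in `PathTuple.eval`
really separates the two realizers. -/
theorem highR_ne_lowR {n : ℕ} (σ : Fin n → Bool) (k : Fin (n + 1)) : highR σ k ≠ lowR σ k := by
  intro h
  have h' := congrArg fst h
  simp only [highR, lowR, fst_pair, num, Set.singleton_eq_singleton_iff] at h'
  omega

theorem PathTuple.comp_id {X : Type u} {n : ℕ} (φ : PathTuple X n) (σ : Fin n → Bool) :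
    φ.comp (IntervalMap.id σ) = φ := by
  cases φ
  simp only [PathTuple.comp, PathTuple.eval, IntervalMap.id, graph_app cont_id, if_true,
    if_neg (highR_ne_lowR σ _)]

theorem entails_chainRel (X : Obj.{u}) : Entails (pathRel X) (chainRel X) := by
  obtain ⟨s, hs⟩ := X.symm
  obtain ⟨t, ht⟩ := X.trans
  -- The two end-point equalities are absorbed into the first and last edges, at indices 0 and N - 1
  -- = 3n. These differ because n ≥ 1.
  refine ⟨graph fun A => bindNum (fst (proj 0 (proj 0 A))) fun N => tuple N fun i =>
    if i = 0 then t ⬝ (s ⬝ proj 1 A) ⬝ proj 0 (proj 0 (proj 0 A)) else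
    if i = N - 1 then t ⬝ proj i (proj 0 (proj 0 A)) ⬝ proj 2 A else
      proj i (proj 0 (proj 0 A)), ?_⟩
  rintro a b _ ⟨n, hn, φ, _, ⟨α, r, β, rfl, σ, -, hα, -⟩, U, hU, V, hV, rfl⟩
  obtain ⟨x, y, c, hc, rfl, hx, hy⟩ := exists_isChain hα
  rw [← hx] at hU
  rw [← hy] at hV
  rw [graph_app (by fun_prop)]
  simp only [proj_zero_triple, proj_one_triple, proj_two_triple, fst_tuple, bindNum_num,
    add_tsub_cancel_right]
  refine ⟨n, hn, fun k => if k = 0 then a else x k, fun k => if k = n then b else y k,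
    fun i => if i = 0 then t ⬝ (s ⬝ U) ⬝ c 0 else if i = 3 * n then t ⬝ c i ⬝ V else c i,
    ⟨fun k hk => ?_, fun k hk => ?_, fun k hk => ?_, fun k hk => ?_⟩, by simp, by simp,
    tuple_congr fun i hi => ?_⟩
  · rcases eq_or_ne k 0 with rfl | h0
    · simpa [show 0 ≠ n by omega] using ht _ _ _ _ (hs _ _ _ hU) _ (hc.edge 0 hk)
    · rcases eq_or_ne k n with rfl | h1
      · simpa [h0] using ht _ _ _ _ (hc.edge k hk) _ hV
      · simpa [h0, h1] using hc.edge k hk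
  · rw [if_neg (by omega), if_neg (by omega), if_neg (by omega)]
    exact hc.high k hk
  · rw [if_neg (by omega), if_neg (by omega), if_neg (by omega)]
    exact hc.low k hk
  · rw [if_neg (by omega), if_neg (by omega), if_neg (by omega), if_neg (by omega)]
    exact hc.comparable k hk
  · rw [proj_tuple (by omega), proj_tuple hi]

theorem chainRel_entails (X : Obj.{u}) : Entails (chainRel X) (pathRel X) := by
  obtain ⟨l, hl⟩ := (FunRel.id X).strict_left
  obtain ⟨r, hr⟩ := (FunRel.id X).strict_right
  -- The tuple is compared with itself along the identity of the interval, so `A` supplies all the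
  -- existence data; equality at x_k comes from strictness of the k-th edge.
  refine ⟨graph fun A => triple
    (triple A (triple A A (graph fun K => bindNum K fun k => l ⬝ proj (3 * k) A)) A)
    (l ⬝ proj 0 A) (bindNum (fst A) fun N => r ⬝ proj (N - 1) A), ?_⟩
  rintro a b _ ⟨n, hn, x, y, c, hc, rfl, rfl, rfl⟩
  obtain ⟨σ, hσ⟩ := hc.exists_mem_intervalExt
  rw [graph_app (by fun_prop)]
  refine ⟨n, hn, _, _, ⟨_, _, _, rfl, σ, σ, hσ, hσ, n, σ, IntervalMap.id σ, IntervalMap.id σ, hn,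
    ?_⟩, _, ?_, _, ?_, rfl⟩
  · rw [PathTuple.comp_id]
    refine ⟨_, _, _, rfl, hσ, hσ, fun k => ?_⟩
    rw [graph_app (by fun_prop), bindNum_num, proj_tuple (by omega)]
    exact hl _ _ _ (hc.edge k (by omega))
  · rw [proj_tuple (by omega)]
    exact hl _ _ _ (hc.edge 0 (by omega))
  · rw [fst_tuple, bindNum_num, add_tsub_cancel_right, proj_tuple (by omega)]
    exact hr _ _ _ (hc.edge n le_rfl)

/-- The chain of length one (a, y, x, b). It serves both reflexivity and order-discreteness of the
quotient. -/
theorem quad_mem_chainRel {X : Obj.{u}} {a b x y : X} {U V W Z : S} (hU : U ∈ X.eqv a y)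
    (hV : V ∈ X.eqv y y) (hW : W ∈ X.eqv x x) (hZ : Z ∈ X.eqv x b) (h : V ⊆ W ∨ W ⊆ V) :
    quad U V W Z ∈ chainRel X a b := by
  refine ⟨1, le_rfl, fun k => if k = 0 then a else x, fun k => if k = 0 then y else b, _,
    ⟨fun k hk => ?_, fun k hk => ?_, fun k hk => ?_, fun k hk => ?_⟩, rfl, rfl, rfl⟩
  · obtain rfl | rfl : k = 0 ∨ k = 1 := by omega
    · exact hU
    · exact hZ
  all_goals obtain rfl : k = 0 := by omega
  · exact hV
  · exact hW
  · exact h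

/-! ### The chain relation is an equivalence relation. -/

theorem chainRel_of_eqv (X : Obj.{u}) : Entails X.eqv (chainRel X) := by
  obtain ⟨r, hr⟩ := (FunRel.id X).strict_right
  refine ⟨graph fun U => quad U (r ⬝ U) (r ⬝ U) (r ⬝ U), fun x x' U hU => ?_⟩
  rw [graph_app (by fun_prop)]
  have h := hr _ _ _ hU
  exact quad_mem_chainRel hU h h h (Or.inl subset_rfl)

theorem chainRel_strict_left (X : Obj.{u}) :
    ∃ A : S, ∀ x y, ∀ U ∈ chainRel X x y, A ⬝ U ∈ X.eqv x x := by
  obtain ⟨l, hl⟩ := (FunRel.id X).strict_left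
  refine ⟨graph fun A => l ⬝ proj 0 A, ?_⟩
  rintro a b _ ⟨n, hn, x, y, c, hc, rfl, rfl, rfl⟩
  rw [graph_app (by fun_prop), proj_tuple (by omega)]
  exact hl _ _ _ (hc.edge 0 (by omega))

/-- Reversing the list exchanges the two realizers of each link and leaves them unchanged, so
comparability survives; only the edges (indices divisible by 3) must be inverted. -/
theorem chainRel_symm (X : Obj.{u}) :
    ∃ A : S, ∀ x y, ∀ U ∈ chainRel X x y, A ⬝ U ∈ chainRel X y x := by
  obtain ⟨s, hs⟩ := X.symm
  refine ⟨graph fun A => bindNum (fst A) fun N => tuple N fun i =>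
    if i % 3 = 0 then s ⬝ proj (N - 1 - i) A else proj (N - 1 - i) A, ?_⟩
  rintro a b _ ⟨n, hn, x, y, c, hc, rfl, rfl, rfl⟩
  rw [graph_app (by fun_prop)]
  simp only [fst_tuple, bindNum_num, add_tsub_cancel_right]
  refine ⟨n, hn, fun k => y (n - k), fun k => x (n - k),
    fun i => if i % 3 = 0 then s ⬝ c (3 * n - i) else c (3 * n - i),
    ⟨fun k hk => ?_, fun k hk => ?_, fun k hk => ?_, fun k hk => ?_⟩, rfl, by simp,
    tuple_congr fun i hi => by rw [proj_tuple (by omega)]⟩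
  · rw [if_pos (by omega), ← Nat.mul_sub]
    exact hs _ _ _ (hc.edge _ (by omega))
  all_goals
    obtain ⟨j, rfl⟩ : ∃ j, n = k + 1 + j := ⟨n - k - 1, by omega⟩
    have e1 : 3 * (k + 1 + j) - (3 * k + 1) = 3 * j + 2 := by omega
    have e2 : 3 * (k + 1 + j) - (3 * k + 2) = 3 * j + 1 := by omega
    have e3 : k + 1 + j - k = j + 1 := by omega
    have e4 : k + 1 + j - (k + 1) = j := by omega
  · rw [if_neg (by omega), e1, e3]
    exact hc.low j (by omega)
  · rw [if_neg (by omega), e2, e4]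
    exact hc.high j (by omega)
  · rw [if_neg (by omega), if_neg (by omega), e1, e2]
    exact (hc.comparable j (by omega)).symm

/-- The last edge of the first chain ends where the first edge of the second begins, so the two are
merged into one by transitivity. This is why the concatenated code is one entry shorter than the
sum. -/
theorem chainRel_trans (X : Obj.{u}) :
    ∃ A : S, ∀ x y z, ∀ U ∈ chainRel X x y, ∀ V ∈ chainRel X y z, A ⬝ U ⬝ V ∈ chainRel X x z := by
  obtain ⟨t, ht⟩ := X.trans
  refine ⟨graph fun A => graph fun B => bindNum (fst A) fun N => bindNum (fst B) fun M =>
    tuple (N + M - 1) fun i => if i < N - 1 then proj i A else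
      if i = N - 1 then t ⬝ proj i A ⬝ proj 0 B else proj (i - (N - 1)) B, ?_⟩
  rintro a b d _ ⟨n, hn, x, y, c, hc, rfl, rfl, rfl⟩ _ ⟨m, hm, x', y', c', hc', hx', rfl, rfl⟩
  rw [graph_app (by fun_prop), graph_app (by fun_prop)]
  simp only [fst_tuple, bindNum_num, add_tsub_cancel_right]
  rw [show 3 * n + 1 + (3 * m + 1) - 1 = 3 * (n + m) + 1 by omega]
  refine ⟨n + m, by omega, fun k => if k ≤ n then x k else x' (k - n),
    fun k => if k < n then y k else y' (k - n),
    fun i => if i < 3 * n then c i else if i = 3 * n then t ⬝ c i ⬝ c' 0 else c' (i - 3 * n),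
    ⟨fun k hk => ?_, fun k hk => ?_, fun k hk => ?_, fun k hk => ?_⟩, rfl, by simp,
    tuple_congr fun i hi => ?_⟩
  · rcases lt_trichotomy k n with h | rfl | h
    · rw [if_pos (by omega), if_pos (by omega), if_pos (by omega)]
      exact hc.edge k h.le
    · have h0 := hc'.edge 0 (by omega)
      rw [hx'] at h0
      simpa using ht _ _ _ _ (hc.edge k le_rfl) _ h0
    · rw [if_neg (by omega), if_neg (by omega), if_neg (by omega), if_neg (by omega),
        ← Nat.mul_sub]
      exact hc'.edge _ (by omega)
  · rcases lt_or_ge k n with h | h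
    · rw [if_pos (by omega), if_pos (by omega)]
      exact hc.high k h
    · rw [if_neg (by omega), if_neg (by omega), if_neg (by omega),
        show 3 * k + 1 - 3 * n = 3 * (k - n) + 1 by omega]
      exact hc'.high _ (by omega)
  · rcases lt_or_ge k n with h | h
    · rw [if_pos (by omega), if_pos (by omega)]
      exact hc.low k h
    · rw [if_neg (by omega), if_neg (by omega), if_neg (by omega),
        show 3 * k + 2 - 3 * n = 3 * (k - n) + 2 by omega, Nat.sub_add_comm h]
      exact hc'.low _ (by omega)
  · rcases lt_or_ge k n with h | h
    · rw [if_pos (by omega), if_pos (by omega)]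
      exact hc.comparable k h
    · rw [if_neg (by omega), if_neg (by omega), if_neg (by omega), if_neg (by omega),
        show 3 * k + 1 - 3 * n = 3 * (k - n) + 1 by omega,
        show 3 * k + 2 - 3 * n = 3 * (k - n) + 2 by omega]
      exact hc'.comparable _ (by omega)
  · split_ifs with h1 h2
    · rw [proj_tuple (by omega)]
    · rw [proj_tuple (by omega), proj_tuple (by omega)]
    · rw [proj_tuple (by omega)]

theorem chainRel_isEquivRel (X : Obj.{u}) : X.IsEquivRel (chainRel X) := by
  obtain ⟨l, hl⟩ := chainRel_strict_left X
  obtain ⟨i, hi⟩ := chainRel_of_eqv X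
  obtain ⟨s, hs⟩ := chainRel_symm X
  obtain ⟨t, ht⟩ := chainRel_trans X
  -- Relationality is transitivity, once the equalities at both ends are turned into chains.
  refine ⟨⟨l, hl⟩, ⟨graph fun U => l ⬝ (s ⬝ U), fun x y U hU => ?_⟩,
    ⟨graph fun U => graph fun V => graph fun W => t ⬝ (t ⬝ (s ⬝ (i ⬝ V)) ⬝ U) ⬝ (i ⬝ W),
      fun x x' y y' U hU V hV W hW => ?_⟩, ⟨i, fun x => hi x x⟩, ⟨s, hs⟩, ⟨t, ht⟩⟩
  · rw [graph_app (by fun_prop)]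
    exact hl _ _ _ (hs _ _ _ hU)
  · rw [graph_app (by fun_prop), graph_app (by fun_prop), graph_app (by fun_prop)]
    exact ht _ _ _ _ (ht _ _ _ _ (hs _ _ _ (hi _ _ _ hV)) _ hU) _ (hi _ _ _ hW)

theorem Obj.IsEquivRel.of_entails {X : Obj.{u}} {R T : X → X → Set S} (hR : X.IsEquivRel R)
    (h₁ : Entails R T) (h₂ : Entails T R) : X.IsEquivRel T := by
  obtain ⟨i, hi⟩ := h₁
  obtain ⟨j, hj⟩ := h₂
  obtain ⟨⟨A, hA⟩, ⟨B, hB⟩, ⟨C, hC⟩, ⟨D, hD⟩, ⟨s, hs⟩, ⟨t, ht⟩⟩ := hR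
  refine ⟨⟨graph fun U => A ⬝ (j ⬝ U), fun x y U hU => ?_⟩,
    ⟨graph fun U => B ⬝ (j ⬝ U), fun x y U hU => ?_⟩,
    ⟨graph fun U => graph fun V => graph fun W => i ⬝ (C ⬝ (j ⬝ U) ⬝ V ⬝ W),
      fun x x' y y' U hU V hV W hW => ?_⟩,
    ⟨graph fun U => i ⬝ (D ⬝ U), fun x U hU => ?_⟩,
    ⟨graph fun U => i ⬝ (s ⬝ (j ⬝ U)), fun x y U hU => ?_⟩,
    ⟨graph fun U => graph fun V => i ⬝ (t ⬝ (j ⬝ U) ⬝ (j ⬝ V)), fun x y z U hU V hV => ?_⟩⟩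
  · rw [graph_app (by fun_prop)]
    exact hA _ _ _ (hj _ _ _ hU)
  · rw [graph_app (by fun_prop)]
    exact hB _ _ _ (hj _ _ _ hU)
  · rw [graph_app (by fun_prop), graph_app (by fun_prop), graph_app (by fun_prop)]
    exact hi _ _ _ (hC _ _ _ _ _ (hj _ _ _ hU) _ hV _ hW)
  · rw [graph_app (by fun_prop)]
    exact hi _ _ _ (hD _ _ hU)
  · rw [graph_app (by fun_prop)]
    exact hi _ _ _ (hs _ _ _ (hj _ _ _ hU))
  · rw [graph_app (by fun_prop), graph_app (by fun_prop)]
    exact hi _ _ _ (ht _ _ _ _ (hj _ _ _ hU) _ (hj _ _ _ hV))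

theorem pathRel_isEquivRel (X : Obj.{u}) : X.IsEquivRel (pathRel X) :=
  (chainRel_isEquivRel X).of_entails (chainRel_entails X) (entails_chainRel X)

/-! ## The order-discrete reflection -/

/-- Strictness has a monotone realizer `l`, so `U ⊆ V` gives `l ⬝ U ⊆ l ⬝ V`, realizers of existence
in X itself: a single link joins the two points. -/
theorem quot_pathRel_orderDiscrete (X : Obj.{u}) (hR : X.IsEquivRel (pathRel X)) :
    (X.quot (pathRel X) hR).OrderDiscrete := by
  obtain ⟨l, hl⟩ := hR.strict_left
  obtain ⟨i, hi⟩ := chainRel_entails X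
  refine orderDiscrete_iff.2 ⟨graph fun U => graph fun V =>
    i ⬝ quad (l ⬝ U) (l ⬝ U) (l ⬝ V) (l ⬝ V), fun a b U hU V hV h => ?_⟩
  rw [graph_app (by fun_prop), graph_app (by fun_prop)]
  have ha := hl _ _ _ hU
  have hb := hl _ _ _ hV
  exact hi _ _ _ (quad_mem_chainRel ha ha hb hb (Or.inl (app_mono subset_rfl h)))

/-- Transport along the first `k` links of a chain, where `r` is applied to an edge and `q` to the
two realizers of a link. -/
def transport (r q : S) (A W : S) : ℕ → S
  | 0 => r ⬝ W ⬝ proj 0 A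
  | k + 1 => r ⬝ (q ⬝ transport r q A W k ⬝ proj (3 * k + 1) A ⬝ proj (3 * k + 2) A) ⬝
      proj (3 * (k + 1)) A

@[fun_prop]
theorem cont_transport {r q : S} {k : ℕ} {F G : S → S} (hF : Cont F) (hG : Cont G) :
    Cont (fun U => transport r q (F U) (G U) k) := by
  induction k with
  | zero => unfold transport; fun_prop
  | succ k ih => unfold transport; fun_prop

/-- Functional relations to order-discrete objects respect the existence of paths. -/
theorem FunRel.exists_transport {X Y : Obj.{u}} (F : FunRel X Y) (hY : Y.OrderDiscrete) :
    ∃ T : S, ∀ a b z, ∀ A ∈ pathRel X a b, ∀ W ∈ F.rel a z, T ⬝ A ⬝ W ∈ F.rel b z := by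
  obtain ⟨H, hH⟩ := hY.exists_of_comparable
  obtain ⟨C, hC⟩ := F.strict_right
  obtain ⟨L, hL⟩ := F.relational
  obtain ⟨D, hD⟩ := F.total
  obtain ⟨K, hK⟩ := F.single_valued
  obtain ⟨s, hs⟩ := Y.symm
  obtain ⟨t, ht⟩ := Y.trans
  obtain ⟨i, hi⟩ := entails_chainRel X
  have hr : ∃ r : S, ∀ x y z, ∀ W ∈ F.rel x z, ∀ U ∈ X.eqv x y, r ⬝ W ⬝ U ∈ F.rel y z := by
    refine ⟨graph fun W => graph fun U => L ⬝ W ⬝ U ⬝ (C ⬝ W), fun x y z W hW U hU => ?_⟩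
    rw [graph_app (by fun_prop), graph_app (by fun_prop)]
    exact hL _ _ _ _ _ hW _ hU _ (hC _ _ _ hW)
  -- Crossing a link: totality at `V` and at `W` gives values z₁ and z₂ whose existence realizers
  -- are again comparable, so z = z₁ by single-valuedness and z₁ = z₂ by order-discreteness of Y.
  have hq : ∃ q : S, ∀ x y z, ∀ Z ∈ F.rel y z, ∀ V ∈ X.eqv y y, ∀ W ∈ X.eqv x x,
      (V ⊆ W ∨ W ⊆ V) → q ⬝ Z ⬝ V ⬝ W ∈ F.rel x z := by
    refine ⟨graph fun Z => graph fun V => graph fun W => L ⬝ (D ⬝ W) ⬝ W ⬝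
      (s ⬝ (t ⬝ (K ⬝ Z ⬝ (D ⬝ V)) ⬝ (H ⬝ (C ⬝ (D ⬝ V)) ⬝ (C ⬝ (D ⬝ W))))),
      fun x y z Z hZ V hV W hW h => ?_⟩
    rw [graph_app (by fun_prop), graph_app (by fun_prop), graph_app (by fun_prop)]
    obtain ⟨z₁, h₁⟩ := hD _ _ hV
    obtain ⟨z₂, h₂⟩ := hD _ _ hW
    refine hL _ _ _ _ _ h₂ _ hW _ (hs _ _ _ (ht _ _ _ _ (hK _ _ _ _ hZ _ h₁) _
      (hH _ _ _ (hC _ _ _ h₁) _ (hC _ _ _ h₂) ?_)))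
    exact h.imp (fun h => app_mono subset_rfl (app_mono subset_rfl h))
      (fun h => app_mono subset_rfl (app_mono subset_rfl h))
  obtain ⟨r, hr⟩ := hr
  obtain ⟨q, hq⟩ := hq
  -- The code has N = 3n + 1 entries, so `N / 3` is the length n of the chain.
  refine ⟨graph fun A => graph fun W => bindNum (fst (i ⬝ A)) fun N =>
    transport r q (i ⬝ A) W (N / 3), fun a b z A hA W hW => ?_⟩
  rw [graph_app (by fun_prop), graph_app (by fun_prop)]
  obtain ⟨n, -, x, y, c, hc, rfl, rfl, h⟩ := hi _ _ _ hA
  rw [h, fst_tuple, bindNum_num, show (3 * n + 1) / 3 = n by omega]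
  have key : ∀ k ≤ n, transport r q (tuple (3 * n + 1) c) W k ∈ F.rel (y k) z := by
    intro k
    induction k with
    | zero =>
      intro hk
      rw [transport, proj_tuple (by omega)]
      exact hr _ _ _ _ hW _ (hc.edge 0 hk)
    | succ k ih =>
      intro hk
      rw [transport, proj_tuple (by omega), proj_tuple (by omega), proj_tuple (by omega)]
      exact hr _ _ _ _ (hq _ _ _ _ (ih (by omega)) _ (hc.high k hk) _ (hc.low k hk)
        (hc.comparable k hk)) _ (hc.edge (k + 1) hk)
  exact key n le_rfl

/-- The functional relation induced on a quotient by one that respects the equivalence relation. -/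
def FunRel.desc {X Y : Obj.{u}} (F : FunRel X Y) {R : X → X → Set S} (hR : X.IsEquivRel R)
    (h : ∃ T : S, ∀ a b z, ∀ A ∈ R a b, ∀ W ∈ F.rel a z, T ⬝ A ⬝ W ∈ F.rel b z) :
    FunRel (X.quot R hR) Y where
  rel := F.rel
  strict_left := by
    obtain ⟨A, hA⟩ := F.strict_left
    obtain ⟨B, hB⟩ := hR.refl
    refine ⟨graph fun U => B ⬝ (A ⬝ U), fun x y U hU => ?_⟩
    rw [graph_app (by fun_prop)]
    exact hB _ _ (hA _ _ _ hU)
  strict_right := F.strict_right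
  relational := by
    obtain ⟨T, hT⟩ := h
    obtain ⟨A, hA⟩ := F.relational
    obtain ⟨B, hB⟩ := F.strict_left
    refine ⟨graph fun U => graph fun V => graph fun W => A ⬝ (T ⬝ V ⬝ U) ⬝ (B ⬝ (T ⬝ V ⬝ U)) ⬝ W,
      fun x x' y y' U hU V hV W hW => ?_⟩
    rw [graph_app (by fun_prop), graph_app (by fun_prop), graph_app (by fun_prop)]
    have h := hT _ _ _ _ hV _ hU
    exact hA _ _ _ _ _ h _ (hB _ _ _ h) _ hW
  single_valued := F.single_valued
  total := by
    obtain ⟨A, hA⟩ := F.total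
    obtain ⟨B, hB⟩ := hR.strict_left
    refine ⟨graph fun U => A ⬝ (B ⬝ U), fun x U hU => ?_⟩
    rw [graph_app (by fun_prop)]
    exact hA _ _ (hB _ _ _ hU)

/-- The underlying relation of `q ≫ G` is that of `G`. -/
theorem entails_quotMap_comp {X Y : Obj.{u}} {R : X → X → Set S} (hR : X.IsEquivRel R)
    (G : FunRel (X.quot R hR) Y) (F : FunRel X Y)
    (h : X.quotMap R hR ≫ (Quotient.mk _ G : X.quot R hR ⟶ Y) = Quotient.mk _ F) :
    Entails G.rel F.rel ∧ Entails F.rel G.rel := by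
  obtain ⟨h₁, h₂⟩ := Quotient.exact h
  obtain ⟨A, hA⟩ := G.strict_left
  obtain ⟨B, hB⟩ := hR.strict_left
  obtain ⟨s, hs⟩ := hR.symm
  obtain ⟨C, hC⟩ := G.relational
  obtain ⟨D, hD⟩ := G.strict_right
  -- For one direction the intermediate point is x itself, by strictness; for the other, `G` is
  -- relational for R, so the intermediate point can be moved back to x.
  refine ⟨Entails.trans ⟨graph fun U => pair (pair (B ⬝ (A ⬝ U)) (A ⬝ U)) U,
    fun x z U hU => ?_⟩ h₁, h₂.trans ⟨graph fun W => C ⬝ snd W ⬝ (s ⬝ snd (fst W)) ⬝ (D ⬝ snd W),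
      ?_⟩⟩
  · rw [graph_app (by fun_prop)]
    have h := hA _ _ _ hU
    exact ⟨x, _, ⟨_, hB _ _ _ h, _, h, rfl⟩, _, hU, rfl⟩
  · rintro x z _ ⟨y, _, ⟨U, hU, V, hV, rfl⟩, W, hW, rfl⟩
    rw [graph_app (by fun_prop)]
    simp only [fst_pair, snd_pair]
    exact hC _ _ _ _ _ hW _ (hs _ _ _ hV) _ (hD _ _ _ hW)

theorem quotMap_comp_desc {X Y : Obj.{u}} {R : X → X → Set S} (hR : X.IsEquivRel R)
    (F : FunRel X Y)
    (h : ∃ T : S, ∀ a b z, ∀ A ∈ R a b, ∀ W ∈ F.rel a z, T ⬝ A ⬝ W ∈ F.rel b z) :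
    X.quotMap R hR ≫ (Quotient.mk _ (F.desc hR h) : X.quot R hR ⟶ Y) = Quotient.mk _ F := by
  have ⟨T, hT⟩ := h
  obtain ⟨s, hs⟩ := hR.symm
  obtain ⟨A, hA⟩ := F.strict_left
  obtain ⟨B, hB⟩ := hR.refl
  refine Quotient.sound ⟨⟨graph fun W => T ⬝ (s ⬝ snd (fst W)) ⬝ snd W, ?_⟩,
    ⟨graph fun U => pair (pair (A ⬝ U) (B ⬝ (A ⬝ U))) U, fun x z U hU => ?_⟩⟩
  · rintro x z _ ⟨y, _, ⟨U, hU, V, hV, rfl⟩, W, hW, rfl⟩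
    rw [graph_app (by fun_prop)]
    simp only [fst_pair, snd_pair]
    exact hT _ _ _ _ (hs _ _ _ hV) _ hW
  · rw [graph_app (by fun_prop)]
    have h := hA _ _ _ hU
    exact ⟨x, _, ⟨_, h, _, hB _ _ h, rfl⟩, _, hU, rfl⟩

theorem quotMap_isOrderDiscreteReflection (X : Obj.{u}) (hR : X.IsEquivRel (pathRel X)) :
    IsOrderDiscreteReflection (X.quotMap (pathRel X) hR) := by
  refine ⟨quot_pathRel_orderDiscrete X hR, fun Y hY f => ?_⟩
  induction f using Quotient.inductionOn with
  | h F =>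
    refine ⟨Quotient.mk _ (F.desc hR (F.exists_transport hY)), quotMap_comp_desc hR F _, ?_⟩
    intro g hg
    induction g using Quotient.inductionOn with
    -- Uniqueness: `F.desc` has the same underlying relation as `F`, and so does `G` up to
    -- entailment.
    | h G => exact Quotient.sound (entails_quotMap_comp hR G F hg)

end ScottRT

theorem mainTheorem2 (X : ScottRT.Obj.{u}) :
    ∃ hR : X.IsEquivRel (ScottRT.pathRel X),
      ScottRT.IsOrderDiscreteReflection (X.quotMap (ScottRT.pathRel X) hR) :=
  ⟨ScottRT.pathRel_isEquivRel X, ScottRT.quotMap_isOrderDiscreteReflection X _⟩
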